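/- Let $d\ge 0$ and $A=C^\infty(\mathbb R^d)$. Let $\mathcal V=\bigoplus_{k\ge 0}\Gamma(\bigwedge^kT\mathbb R^d)$ be the space of multivector fields and $\mathcal D=\bigoplus_{m\ge 0}\mathcal D_m$ the space of multidifferential operators, $\mathcal D_m$ consisting of the multidifferential operators $A^{\otimes m}\to A$ that vanish when one of the arguments is constant. *Kontsevich's map.* For $n\ge1$, $m\ge0$ let $\mathcal G_{n,m}$ be the set of admissible graphs: connected oriented graphs without loops and without multiple edges, with labelled vertices $1,\dots,n$ (first type) and $\bar1,\dots,\bar m$ (second type), all of whose edges start at vertices of the first type, with a chosen ordering of the set $\mathrm{Star}(v)$ of edges starting at $v$ for each vertex $v$ of the first type; graphs that differ in these orderings are different elements. For $\Gamma\in\mathcal G_{n,m}$ with exactly $2n+m-2$ edges put $$w_\Gamma=\prod_{v=1}^n\frac1{(\#\mathrm{Star}(v))!}\;\frac1{(2\pi)^{2n+m-2}}\int_{C^+_{n,m}}\bigwedge_{e}d\phi_e ,$$ and $w_\Gamma=0$ otherwise. Here $C_{n,m}$ is the space of configurations of $n$ distinct points $z_i$ of the open upper half plane and $m$ distinct real points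 $x_j$, modulo $z\mapsto az+b$ ($a>0$, $b\in\mathbb R$), oriented by the standard coordinates of $z_2,\dots,z_n,x_1,\dots,x_m$ on the slice $z_1=i$; $C^+_{n,m}\subset C_{n,m}$ is the part where $x_1<\dots<x_m$; $\phi_e$ is the hyperbolic angle $\arg\frac{q-p}{q-\bar p}$ for an edge $e$ from $p$ to $q$; and the edges are ordered lexicographically. Let $B_\Gamma(\xi_1,\dots,\xi_n)$ be the multidifferential operator obtained by placing at the vertex $v$ with $k$ outgoing edges the components $\xi_v^{j_1\cdots j_k}=\langle\xi_v,dx^{j_1}\wedge\dots\wedge dx^{j_k}\rangle$ (normalised by $\langle X_1\wedge\dots\wedge X_k,\alpha_1\wedge\dots\wedge\alpha_k\rangle=\det(\alpha_i(X_j))$) and at $\bar 1,\dots,\bar m$ the arguments $f_1,\dots,f_m$, each edge standing for a partial derivative acting on what is placed at its endpoint, and summing over all indices; only the component of $\xi_v$ of degree $\#\mathrm{Star}(v)$ contributes. Let $U_n=\sum_{m\ge0}\sum_{\Gamma\in\mathcal G_{n,m}}w_\Gamma B_\Gamma$. **Lemma I.** The first Taylor coefficient $U_1$ is a linear map $\mathcal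 V\to\mathcal D$ which sends each multivector field to the corresponding multiderivation (the HKR map): for a $k$-vector field $\xi$, $U_1(\xi)$ is the skew-symmetric multiderivation with $k$ arguments $$U_1(\xi)(f_1,\dots,f_k)=\frac1{k!}\langle\xi,df_1\wedge\dots\wedge df_k\rangle ,$$ so that for vector fields $X_1,\dots,X_k$ $$U_1(X_1\wedge\dots\wedge X_k)(f_1,\dots,f_k)=\frac1{k!}\sum_{\sigma\in S_k}\mathrm{sgn}(\sigma)\,X_{\sigma(1)}(f_1)\cdots X_{\sigma(k)}(f_k).$$ Moreover, for every $m\ge0$, up to the ordering of $\mathrm{Star}(1)$ the set $\mathcal G_{1,m}$ consists of a single graph $\Gamma_m$, with one edge from the vertex $1$ to each of $\bar1,\dots,\bar m$. That is, its elements are exactly the $\Gamma_{m,\sigma}$, $\sigma\in S_m$, whose $l$-th edge ends at $\overline{\sigma(l)}$, with $\Gamma_m=\Gamma_{m,\mathrm{id}}$. One has $w_{\Gamma_{m,\sigma}}=\mathrm{sgn}(\sigma)/(m!)^2$. The total weight of $\Gamma_m$ is $\sum_\sigma\mathrm{sgn}(\sigma)\,w_{\Gamma_{m,\sigma}}=1/m!$.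 Integrating over all of $C_{1,m}$ instead of $C^+_{1,m}$ in the definition of the weight of $\Gamma_{m,\sigma}$ gives $\mathrm{sgn}(\sigma)/m!$, which for $\Gamma_m$ is again $1/m!$. Finally, $B_{\Gamma_m}(\xi)(f_1,\dots,f_m)=\sum_{j_1,\dots,j_m}\xi^{j_1\cdots j_m}\,\partial_{j_1}f_1\cdots\partial_{j_m}f_m$, and the component of $U_1(\xi)$ with $m$ arguments is $\frac1{m!}B_{\Gamma_m}(\xi)$. -/

import Mathlib

open scoped ContDiff

namespace Kontsevich

noncomputable section

/-! ## Smooth functions and partial derivatives on `ℝ^d` -/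

/-- The space `ℝ^d`. -/
abbrev Space (d : ℕ) : Type := EuclideanSpace ℝ (Fin d)

/-- The algebra `A = C^∞(ℝ^d)` of real valued smooth functions. -/
def SmoothFun (d : ℕ) : Subalgebra ℝ (Space d → ℝ) where
  carrier := {f | ContDiff ℝ ∞ f}
  mul_mem' := fun {f g} (hf : ContDiff ℝ ∞ f) (hg : ContDiff ℝ ∞ g) => hf.mul hg
  add_mem' := fun {f g} (hf : ContDiff ℝ ∞ f) (hg : ContDiff ℝ ∞ g) => hf.add hg
  algebraMap_mem' c := (contDiff_const : ContDiff ℝ ∞ fun _ : Space d => c)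

theorem smoothFun_contDiff {d : ℕ} (f : SmoothFun d) : ContDiff ℝ ∞ f.1 := f.2

theorem smoothFun_differentiableAt {d : ℕ} (f : SmoothFun d) (x : Space d) :
    DifferentiableAt ℝ f.1 x := ((smoothFun_contDiff f).differentiable (by simp)) x

/-- The partial derivative `∂_j` as a linear endomorphism of `C^∞(ℝ^d)`. -/
def partialDeriv (d : ℕ) (j : Fin d) : Module.End ℝ (SmoothFun d) where
  toFun f := ⟨fun x => fderiv ℝ f.1 x (EuclideanSpace.single j 1),
    ((smoothFun_contDiff f).fderiv_right (m := ∞) (by simp)).clm_apply contDiff_const⟩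
  map_add' f g := by
    apply Subtype.ext
    funext x
    have h := fderiv_add (smoothFun_differentiableAt f x) (smoothFun_differentiableAt g x)
    exact congrArg (fun L => L (EuclideanSpace.single j 1)) h
  map_smul' c f := by
    apply Subtype.ext
    funext x
    have h := fderiv_const_smul (smoothFun_differentiableAt f x) c
    exact congrArg (fun L => L (EuclideanSpace.single j 1)) h

/-! ## Multivector fields and multidifferential operators -/

/-- The exterior product `α_1 ∧ ⋯ ∧ α_k` of linear forms, as the alternating form
`(v_1, …, v_k) ↦ ∑_σ sgn(σ) ∏_i α_i (v_{σ(i)}) = det (α_i (v_j))`. -/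
def wedgeForms {V : Type*} [AddCommGroup V] [Module ℝ V] {k : ℕ} (α : Fin k → (V →ₗ[ℝ] ℝ)) :
    V [⋀^Fin k]→ₗ[ℝ] ℝ :=
  MultilinearMap.alternatization
    ((MultilinearMap.mkPiAlgebra ℝ (Fin k) ℝ).compLinearMap α)

/-- The natural pairing `⟨τ, α_1 ∧ ⋯ ∧ α_k⟩` of a `k`-vector with a wedge product of `k` covectors,
normalised by `⟨v_1 ∧ ⋯ ∧ v_k, α_1 ∧ ⋯ ∧ α_k⟩ = det (α_i (v_j))`. -/
def pairing {V : Type*} [AddCommGroup V] [Module ℝ V] {k : ℕ} (τ : ⋀[ℝ]^k V)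
    (α : Fin k → (V →ₗ[ℝ] ℝ)) : ℝ :=
  exteriorPower.alternatingMapLinearEquiv (wedgeForms α) τ

/-- The component `τ^{j_1 ⋯ j_k} = ⟨τ, dx^{j_1} ∧ ⋯ ∧ dx^{j_k}⟩` of the skew-symmetric tensor
corresponding to the `k`-vector `τ`. -/
def component {d k : ℕ} (τ : ⋀[ℝ]^k (Space d)) (J : Fin k → Fin d) : ℝ :=
  pairing τ (fun l => (EuclideanSpace.proj (J l) : Space d →L[ℝ] ℝ).toLinearMap)

/-- `k`-vector fields on `ℝ^d`: the smooth sections of `⋀^k T ℝ^d`. -/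
def MultivectorField (d k : ℕ) : Submodule ℝ (Space d → ⋀[ℝ]^k (Space d)) where
  carrier := {ξ | ∀ J : Fin k → Fin d, ContDiff ℝ ∞ (fun x => component (ξ x) J)}
  add_mem' := by
    intro ξ η hξ hη J
    simpa [component, pairing] using ContDiff.add (hξ J) (hη J)
  zero_mem' := by
    intro J
    simpa [component, pairing] using contDiff_const
  smul_mem' := by
    intro c ξ hξ J
    simpa [component, pairing] using contDiff_const.mul (hξ J)

/-- The graded space of multivector fields; the summand `k` has degree `k - 1` in the shifted
grading of the Lie algebra `𝒱`. -/
abbrev Multivectors (d : ℕ) : Type := DirectSum ℕ fun k => MultivectorField d k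

/-- The component `ξ^{j_1 ⋯ j_k}` of a `k`-vector field, as a smooth function. -/
def MultivectorField.coeff {d k : ℕ} (ξ : MultivectorField d k) (J : Fin k → Fin d) :
    SmoothFun d :=
  ⟨fun x => component (ξ.1 x) J, ξ.2 J⟩

/-- `m`-linear maps from `C^∞(ℝ^d)` to itself (Hochschild cochains, of shifted degree `m - 1`). -/
abbrev Cochain (d m : ℕ) : Type :=
  MultilinearMap ℝ (fun _ : Fin m => SmoothFun d) (SmoothFun d)

/-- The cochain `(f_1, …, f_m) ↦ ∏_i D_i (f_i)`. -/
def productCochain {d m : ℕ} (D : Fin m → Module.End ℝ (SmoothFun d)) : Cochain d m :=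
  (MultilinearMap.mkPiAlgebra ℝ (Fin m) (SmoothFun d)).compLinearMap D

/-- Multidifferential operators with `m` arguments, possibly of order `0`: the `C^∞(ℝ^d)`-linear
combinations of `(f_1, …, f_m) ↦ ∂^{K_1} f_1 ⋯ ∂^{K_m} f_m`, where the `∂^{K_i}` are iterated
partial derivatives. -/
def MultidiffOpTilde (d m : ℕ) : Submodule (SmoothFun d) (Cochain d m) :=
  Submodule.span (SmoothFun d)
    {P | ∃ D : Fin m → Module.End ℝ (SmoothFun d),
      (∀ i, D i ∈ Submonoid.closure (Set.range (partialDeriv d))) ∧ P = productCochain D}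

/-- The multidifferential operators with `m` arguments that vanish as soon as one of the arguments
is a constant function. -/
def MultidiffOp (d m : ℕ) : Submodule ℝ (Cochain d m) where
  carrier := {P | P ∈ MultidiffOpTilde d m ∧
    ∀ (f : Fin m → SmoothFun d) (i : Fin m) (c : ℝ), f i = algebraMap ℝ (SmoothFun d) c → P f = 0}
  add_mem' := by
    rintro P Q ⟨hP, hP'⟩ ⟨hQ, hQ'⟩
    exact ⟨add_mem hP hQ, fun f i c h => by simp [hP' f i c h, hQ' f i c h]⟩
  zero_mem' := ⟨zero_mem _, fun _ _ _ _ => rfl⟩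
  smul_mem' := by
    rintro c P ⟨hP, hP'⟩
    refine ⟨?_, fun f i c' h => by simp [hP' f i c' h]⟩
    have h : c • P = algebraMap ℝ (SmoothFun d) c • P := by
      refine MultilinearMap.ext fun f => ?_
      rw [smul_apply, smul_apply]
      exact (algebraMap_smul (SmoothFun d) c (P f)).symm
    exact h ▸ (MultidiffOpTilde d m).smul_mem (algebraMap ℝ (SmoothFun d) c) hP

/-- The graded space `𝒟` of multidifferential operators vanishing on constants; the summand `m` has
degree `m - 1` in the shifted grading. -/
abbrev MultidiffOps (d : ℕ) : Type := DirectSum ℕ fun m => MultidiffOp d m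

/-- A multiderivation: a cochain which satisfies the Leibniz rule in each argument and is
skew-symmetric. -/
def IsMultiderivation {d m : ℕ} (P : Cochain d m) : Prop :=
  (∀ (f : Fin m → SmoothFun d) (i : Fin m) (g h : SmoothFun d),
    P (Function.update f i (g * h)) =
      g * P (Function.update f i h) + P (Function.update f i g) * h) ∧
  ∀ (f : Fin m → SmoothFun d) (σ : Equiv.Perm (Fin m)),
    P (f ∘ σ) = Equiv.Perm.sign σ • P f

/-! ## Admissible graphs and their multidifferential operators -/

/-- Admissible graphs with `n` vertices of the first type and `m` vertices of the second type.
All edges start at a vertex of the first type; an edge is determined by its two endpoints, and the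
ordered set of edges starting at `v` is given as the list `star v` of their endpoints. -/
structure AdmissibleGraph (n m : ℕ) where
  /-- The endpoints of the edges starting at a vertex of the first type, in order. -/
  star : Fin n → List (Fin n ⊕ Fin m)
  nodup : ∀ v, (star v).Nodup
  no_small_loop : ∀ v, Sum.inl v ∉ star v
  two_le : 2 ≤ 2 * n + m
  connected : (SimpleGraph.fromRel fun a b : Fin n ⊕ Fin m =>
    ∃ v, a = Sum.inl v ∧ b ∈ star v).Connected

/-- There are only finitely many admissible graphs on given sets of vertices. -/
instance (n m : ℕ) : Fintype (AdmissibleGraph n m) := by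
  classical
  exact Fintype.ofInjective
    (fun Γ => (fun v => ⟨Γ.star v, Γ.nodup v⟩ : Fin n → {l : List (Fin n ⊕ Fin m) // l.Nodup}))
    (by
      rintro ⟨s, _, _, _, _⟩ ⟨t, _, _, _, _⟩ h
      have : s = t := funext fun v => congrArg Subtype.val (congrFun h v)
      subst this
      rfl)

namespace AdmissibleGraph

variable {n m : ℕ}

/-- The number `# Star(v)` of edges starting at `v`. -/
def outdeg (Γ : AdmissibleGraph n m) (v : Fin n) : ℕ := (Γ.star v).length

/-- The number of edges. -/
def numEdges (Γ : AdmissibleGraph n m) : ℕ := ∑ v, Γ.outdeg v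

/-- The labelling of the edges by `0, …, numEdges - 1` in lexicographic order: first the order of
the starting vertices, then the order in `Star(v)`. -/
def edgeEquiv (Γ : AdmissibleGraph n m) : ((v : Fin n) × Fin (Γ.outdeg v)) ≃ Fin Γ.numEdges :=
  finSigmaFinEquiv

/-- The vertex where an edge starts. -/
def source (Γ : AdmissibleGraph n m) (e : Fin Γ.numEdges) : Fin n := (Γ.edgeEquiv.symm e).1

/-- The vertex where an edge ends. -/
def target (Γ : AdmissibleGraph n m) (e : Fin Γ.numEdges) : Fin n ⊕ Fin m :=
  (Γ.star (Γ.edgeEquiv.symm e).1).get (Γ.edgeEquiv.symm e).2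

/-- The composition of the partial derivatives `∂_{I(e)}` over all edges `e` that end at the
vertex `w`. -/
def incoming (Γ : AdmissibleGraph n m) {d : ℕ} (I : Fin Γ.numEdges → Fin d) (w : Fin n ⊕ Fin m) :
    Module.End ℝ (SmoothFun d) :=
  (((List.finRange Γ.numEdges).filter fun e => Γ.target e = w).map
    fun e => partialDeriv d (I e)).prod

/-- The multidifferential operator `B_Γ(ξ_1 ⊗ ⋯ ⊗ ξ_n)`: the sum over all assignments `I` of an
index to each edge of
`∏_v ∂_{in(v)} ξ_v^{I(Star v)} · ∏_w ∂_{in(w)} f_w`.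
At a vertex with `k` outgoing edges only the `k`-vector field component of `ξ_v` contributes. -/
def B (Γ : AdmissibleGraph n m) {d : ℕ} (ξ : Fin n → Multivectors d) : Cochain d m :=
  ∑ I : Fin Γ.numEdges → Fin d,
    (∏ v : Fin n, Γ.incoming I (Sum.inl v)
      (MultivectorField.coeff (ξ v (Γ.outdeg v)) fun l => I (Γ.edgeEquiv ⟨v, l⟩))) •
    productCochain fun w => Γ.incoming I (Sum.inr w)

end AdmissibleGraph

/-! ## Configuration spaces, the angle form and the weights -/

/-- The ambient space `ℂ^n × ℝ^m` of the configuration space. -/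
abbrev ConfCoord (n m : ℕ) : Type := (Fin n → ℂ) × (Fin m → ℝ)

/-- `Conf_{n,m}`: `n` distinct points in the open upper half plane and `m` distinct points on the
real line. -/
def Conf (n m : ℕ) : Set (ConfCoord n m) :=
  {c | (∀ i, 0 < (c.1 i).im) ∧ Function.Injective c.1 ∧ Function.Injective c.2}

/-- `Conf⁺_{n,m}`: the points on the real line are moreover in ascending order. -/
def ConfPlus (n m : ℕ) : Set (ConfCoord n m) := {c ∈ Conf n m | StrictMono c.2}

/-- The action `z ↦ a z + b` (`a > 0`) on configurations. -/
def affineAct {n m : ℕ} (a b : ℝ) (c : ConfCoord n m) : ConfCoord n m :=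
  (fun i => a * c.1 i + b, fun i => a * c.2 i + b)

/-- The slice `z_1 = i` of the action, parametrised by the remaining points. -/
def slice {n m : ℕ} (p : ConfCoord n m) : ConfCoord (n + 1) m := (Fin.cons Complex.I p.1, p.2)

/-- Each orbit of the group `{z ↦ a z + b | a > 0}` on `Conf_{n+1,m}` meets the slice `z_1 = i` in
exactly one point, which is reached by exactly one group element. The quotient `C_{n+1,m}` is thus
identified with the part of the slice lying in `Conf_{n+1,m}`. -/
theorem slice_existsUnique {n m : ℕ} (c : ConfCoord (n + 1) m) (hc : c ∈ Conf (n + 1) m) :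
    ∃! g : ℝ × ℝ, 0 < g.1 ∧ affineAct g.1 g.2 c ∈ Set.range (slice (n := n) (m := m)) := by
  have h0 := hc.1 0
  refine ⟨(1 / (c.1 0).im, -(c.1 0).re / (c.1 0).im), ⟨by positivity, ?_⟩, ?_⟩
  · refine ⟨(fun i => (affineAct (1 / (c.1 0).im) (-(c.1 0).re / (c.1 0).im) c).1 i.succ,
      (affineAct (1 / (c.1 0).im) (-(c.1 0).re / (c.1 0).im) c).2), ?_⟩
    refine Prod.ext (funext fun i => ?_) rfl
    refine Fin.cases ?_ (fun i => ?_) i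
    · apply Complex.ext
      · simp [slice, affineAct]; field_simp; ring
      · simp [slice, affineAct]; field_simp
    · simp [slice]
  · rintro ⟨a, b⟩ ⟨_, p, hp⟩
    have h := congrFun (congrArg Prod.fst hp) 0
    have hre := congrArg Complex.re h
    have him := congrArg Complex.im h
    simp [slice, affineAct] at hre him
    have ha : a = 1 / (c.1 0).im := by field_simp; linarith
    refine Prod.ext ha ?_
    subst ha
    simp only
    field_simp at hre ⊢
    linarith

/-- A nonzero complex number whose argument is the hyperbolic angle `φ(p, q)` at the point `p` of
the upper half plane, measured counterclockwise, from the geodesic to `+ i ∞` to the geodesic to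
`q`. Indeed `z ↦ (z - p) / (z - p̄)` is the conformal isometry onto the Poincaré disc which maps `p`
to the centre and `+ i ∞` to the boundary point `1`, and the geodesics through the centre are the
diameters. -/
def anglePhase (w : ℂ × ℂ) : ℂ := (w.2 - w.1) / (w.2 - (starRingEnd ℂ) w.1)

/-- The angle map `φ` with values in the circle `ℝ / 2πℤ`. -/
def angleMap (w : ℂ × ℂ) : Real.Angle := ((anglePhase w).arg : Real.Angle)

/-- Comparison with semicircles: for `Re p ≠ Re q` the geodesic through `p` and `q` is an arc of the
circle centred at the real number `c = (|q|² - |p|²) / (2 (Re q - Re p))`, so that its tangent at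
`p` pointing to `q` is a positive multiple of `i (Re q - Re p) (c - p)`; if `Re p = Re q` it is a
multiple of `i (|q|² - |p|²)`. The quotient of this tangent by `i`, the direction of the geodesic to
`+ i ∞`, is a positive multiple of `anglePhase (p, q)`. -/
theorem anglePhase_mul_normSq (p q : ℂ) (h : q ≠ (starRingEnd ℂ) p) :
    anglePhase (p, q) * (Complex.normSq (q - (starRingEnd ℂ) p) : ℂ) =
      ((Complex.normSq q - Complex.normSq p : ℝ) : ℂ) - 2 * ((q.re - p.re : ℝ) : ℂ) * p := by
  have h' : q - (starRingEnd ℂ) p ≠ 0 := sub_ne_zero.mpr h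
  rw [Complex.normSq_eq_conj_mul_self, anglePhase]
  field_simp
  apply Complex.ext <;> simp [Complex.normSq_apply] <;> ring

/-- The `1`-form `dφ` on pairs of points, the pullback of the angular form `Im (du / u)` of the
circle by `anglePhase`. -/
def angleForm (w : ℂ × ℂ) : ℂ × ℂ →ₗ[ℝ] ℝ :=
  Complex.imLm.comp
    ((LinearMap.mulLeft ℝ (anglePhase w)⁻¹).comp (fderiv ℝ anglePhase w).toLinearMap)

/-- Wherever the principal argument is continuous, `dφ` is the derivative of the angle. -/
theorem fderiv_arg_anglePhase (w : ℂ × ℂ) (h : anglePhase w ∈ Complex.slitPlane)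
    (hw : DifferentiableAt ℝ anglePhase w) (v : ℂ × ℂ) :
    fderiv ℝ (fun u => (anglePhase u).arg) w v = angleForm w v := by
  have h1 := ((Complex.hasStrictDerivAt_log h).hasStrictFDerivAt.restrictScalars
    ℝ).hasFDerivAt.comp w hw.hasFDerivAt
  have h2 := (Complex.imCLM.hasFDerivAt).comp w h1
  have h3 : (fun u => (anglePhase u).arg) =
      (Complex.imCLM : ℂ → ℝ) ∘ Complex.log ∘ anglePhase := by
    funext u; simp [Complex.log_im]
  rw [h3, h2.fderiv]
  simp [angleForm, mul_comm]

namespace AdmissibleGraph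

variable {n m : ℕ}

/-- The projection `π_e` of a configuration to the positions of the two endpoints of `e`. -/
def edgeProj (Γ : AdmissibleGraph n m) (e : Fin Γ.numEdges) : ConfCoord n m →ₗ[ℝ] ℂ × ℂ :=
  LinearMap.prod
    ((LinearMap.proj (Γ.source e)).comp (LinearMap.fst ℝ (Fin n → ℂ) (Fin m → ℝ)))
    (Sum.elim
      (fun v => (LinearMap.proj v).comp (LinearMap.fst ℝ (Fin n → ℂ) (Fin m → ℝ)))
      (fun w => Complex.ofRealLI.toLinearMap.comp
        ((LinearMap.proj w).comp (LinearMap.snd ℝ (Fin n → ℂ) (Fin m → ℝ))))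
      (Γ.target e))

/-- The `1`-form `dφ_e = π_e^* dφ`. -/
def edgeForm (Γ : AdmissibleGraph n m) (c : ConfCoord n m) (e : Fin Γ.numEdges) :
    ConfCoord n m →ₗ[ℝ] ℝ :=
  (angleForm (Γ.edgeProj e c)).comp (Γ.edgeProj e)

/-- The form `ω_Γ = ⋀_e dφ_e`, the edges being taken in lexicographic order. -/
def omega (Γ : AdmissibleGraph n m) (c : ConfCoord n m) :
    ConfCoord n m [⋀^Fin Γ.numEdges]→ₗ[ℝ] ℝ :=
  wedgeForms (Γ.edgeForm c)

end AdmissibleGraph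

/-- The coordinate frame of the slice `z_1 = i`, ordered as
`∂/∂x_2, ∂/∂y_2, …, ∂/∂x_{n+1}, ∂/∂y_{n+1}` (for `z_j = x_j + i y_j`) followed by the coordinate
vectors of the `m` real points. It defines the orientation. -/
def sliceFrame (n m : ℕ) (b : Fin (n * 2 + m)) : ConfCoord (n + 1) m :=
  Sum.elim
    (fun a : Fin (n * 2) => (Pi.single (finProdFinEquiv.symm a).1.succ
      (![1, Complex.I] (finProdFinEquiv.symm a).2), 0))
    (fun j : Fin m => (0, Pi.single j 1))
    (finSumFinEquiv.symm b)

namespace AdmissibleGraph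

/-- The integral of `ω_Γ` over the image in the oriented manifold `C_{n+1,m}`, of dimension
`2 (n + 1) + m - 2 = 2 n + m`, of an invariant subset `R` of `Conf_{n+1,m}`; it is computed on the
slice `z_1 = i`. The form is required to have top degree. (The boundary of the compactification of
the configuration space is a null set and does not contribute.) -/
def integral {n m : ℕ} (Γ : AdmissibleGraph (n + 1) m) (h : Γ.numEdges = n * 2 + m)
    (R : Set (ConfCoord (n + 1) m)) : ℝ :=
  ∫ p in {p : ConfCoord n m | slice p ∈ R},
    Γ.omega (slice p) (fun b => sliceFrame n m (Fin.cast h b))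

/-- The weight
`∏_v 1 / (# Star(v))! · 1 / (2π)^(2 (n+1) + m - 2) · ∫_R ω_Γ` for a given region of integration
`R`, and `0` if the number of edges is not `2 (n + 1) + m - 2`. -/
def weightOver {n m : ℕ} (R : Set (ConfCoord (n + 1) m)) (Γ : AdmissibleGraph (n + 1) m) : ℝ :=
  if h : Γ.numEdges = n * 2 + m then
    (∏ v, 1 / ((Γ.outdeg v).factorial : ℝ)) * (1 / (2 * Real.pi) ^ (2 * (n + 1) + m - 2)) *
      Γ.integral h R
  else 0

/-- The weight `w_Γ`, given by the integral over the connected component `C⁺_{n+1,m}`. -/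
def weight {n m : ℕ} (Γ : AdmissibleGraph (n + 1) m) : ℝ := Γ.weightOver (ConfPlus (n + 1) m)

end AdmissibleGraph

/-- The Taylor coefficient `U_{n+1}` of Kontsevich's morphism, evaluated on `n + 1` multivector
fields, as the family of its components in the spaces of `m`-linear cochains, `m ≥ 0`:
`U_{n+1} = ∑_m ∑_{Γ ∈ 𝒢_{n+1,m}} w_Γ B_Γ`. -/
def taylorU {d : ℕ} (n : ℕ) (ξ : Fin (n + 1) → Multivectors d) (m : ℕ) : Cochain d m :=
  ∑ Γ : AdmissibleGraph (n + 1) m, Γ.weight • Γ.B ξ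

/-- The first Taylor coefficient `U_1`. -/
def U1 {d : ℕ} (ξ : Multivectors d) (m : ℕ) : Cochain d m := taylorU 0 (fun _ => ξ) m

/-! ## The natural map -/

/-- The differential `df_x` of a smooth function. -/
def differential {d : ℕ} (f : SmoothFun d) (x : Space d) : Space d →ₗ[ℝ] ℝ :=
  (fderiv ℝ f.1 x).toLinearMap

/-- The (Hochschild–Kostant–Rosenberg) value at `x` of the multiderivation corresponding to a
`k`-vector field: `(1 / k!) ⟨ξ(x), df_1 ∧ ⋯ ∧ df_k⟩`. -/
def hkr {d k : ℕ} (ξ : MultivectorField d k) (f : Fin k → SmoothFun d) (x : Space d) : ℝ :=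
  1 / (k.factorial : ℝ) * pairing (ξ.1 x) (fun i => differential (f i) x)

/-- A multivector field is the wedge product `X_1 ∧ ⋯ ∧ X_k` of vector fields. -/
def IsWedge {d k : ℕ} (ξ : MultivectorField d k) (X : Fin k → Space d → Space d) : Prop :=
  ∀ x, ξ.1 x = exteriorPower.ιMulti ℝ k (fun i => X i x)

end

end Kontsevich

open Kontsevich

/-! With a single vertex of the first type, every edge starts at $1$ and, loops being excluded, ends
at a vertex of the second type. Connectedness forces each $\bar w$ to be hit and the absence of
multiple edges forces it to be hit once, so a graph is just a permutation $\sigma$ listing the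
endpoints (`ofPerm_surjective`). It has $m = 2\cdot 1+m-2$ edges, so the top-degree condition always
holds.

On the slice $z_1=i$ the form of the $l$-th edge depends on $x_{\sigma(l)}$ alone and equals
$2\,dx/(1+x^2)$ there. The matrix of edge forms is therefore diagonal with columns permuted by
$\sigma$, and $\omega_\Gamma$ has density $\mathrm{sgn}(\sigma)\prod_j 2/(1+x_j^2)$
(`omega_ofPerm`). Its integral over all configurations is $\mathrm{sgn}(\sigma)(2\pi)^m$. The
product is symmetric in the points, so the ordered chamber carries the fraction $1/m!$ of it
(`setIntegral_strictMono`). A second $1/m!$ comes from $\mathrm{Star}(1)$.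

Skew-symmetry of the components of $\xi$ gives
$B_{\Gamma_{m,\sigma}}=\mathrm{sgn}(\sigma)B_{\Gamma_m}$ (`B_ofPerm_eq`). In $U_1$ the two signs
cancel, and $m!$ equal terms $B_{\Gamma_m}/(m!)^2$ add up to $B_{\Gamma_m}/m!$, which is the HKR map
by the expansion $df=\sum_j\partial_jf\,dx^j$. -/

namespace Kontsevich

noncomputable section

open MeasureTheory

/-! ### Graphs with one vertex of the first type, and their operators -/

namespace AdmissibleGraph

variable {m : ℕ}

/-- The admissible graph with one vertex of the first type whose `l`-th edge ends at the vertex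
`σ l` of the second type. -/
def ofPerm (σ : Equiv.Perm (Fin m)) : AdmissibleGraph 1 m where
  star _ := List.ofFn fun l => Sum.inr (σ l)
  nodup _ := List.nodup_ofFn.mpr (Sum.inr_injective.comp σ.injective)
  no_small_loop v := by simp
  two_le := by omega
  connected := by
    rw [SimpleGraph.connected_iff_exists_forall_reachable]
    refine ⟨Sum.inl 0, ?_⟩
    rintro (v | w)
    · rw [Subsingleton.elim v 0]
    · refine SimpleGraph.Adj.reachable ?_
      rw [SimpleGraph.fromRel_adj]
      refine ⟨by simp, Or.inl ⟨0, rfl, ?_⟩⟩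
      rw [List.mem_ofFn]
      exact ⟨σ.symm w, by simp⟩

@[ext]
theorem ext_star {n m : ℕ} {Γ Δ : AdmissibleGraph n m} (h : Γ.star = Δ.star) : Γ = Δ := by
  cases Γ; cases Δ; cases h; rfl

theorem ofPerm_injective : Function.Injective (ofPerm (m := m)) := by
  intro σ τ h
  have h' := congrFun (congrArg star h) 0
  have h2 := List.ofFn_injective h'
  ext l : 1
  exact Sum.inr_injective (congrFun h2 l)

/-- In a connected graph with at least two vertices $\bar w$ has a neighbour, and the edge between
them can only start at $1$. -/
theorem inr_mem_star (Γ : AdmissibleGraph 1 m) (w : Fin m) : Sum.inr w ∈ Γ.star 0 := by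
  have : Nontrivial (Fin 1 ⊕ Fin m) := ⟨Sum.inl 0, Sum.inr w, by simp⟩
  obtain ⟨b, hb⟩ := Γ.connected.preconnected.exists_adj_of_nontrivial (Sum.inr w)
  rw [SimpleGraph.fromRel_adj] at hb
  obtain ⟨-, ⟨v, hv, -⟩ | ⟨v, -, hv⟩⟩ := hb
  · cases hv
  · rwa [Subsingleton.elim v 0] at hv

theorem ofPerm_surjective : Function.Surjective (ofPerm (m := m)) := by
  intro Γ
  have hr : ∀ x ∈ Γ.star 0, ∃ w : Fin m, x = Sum.inr w := by
    rintro (v | w) hx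
    · rw [Subsingleton.elim v 0] at hx
      exact absurd hx (Γ.no_small_loop 0)
    · exact ⟨w, rfl⟩
  have hperm : (Γ.star 0).Perm (List.ofFn fun w : Fin m => (Sum.inr w : Fin 1 ⊕ Fin m)) := by
    rw [List.perm_ext_iff_of_nodup (Γ.nodup 0) (List.nodup_ofFn.mpr Sum.inr_injective)]
    intro x
    rw [List.mem_ofFn]
    constructor
    · intro hx
      obtain ⟨w, rfl⟩ := hr x hx
      exact ⟨w, rfl⟩
    · rintro ⟨w, rfl⟩
      exact Γ.inr_mem_star w
  have hlen : (Γ.star 0).length = m := by simpa using hperm.length_eq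
  -- The permutation is read off position by position; it is injective because the list has no
  -- duplicates.
  choose s hs using fun l : Fin m => hr ((Γ.star 0).get (Fin.cast hlen.symm l)) (List.get_mem _ _)
  have hinj : Function.Injective s := by
    intro a b hab
    have h1 : (Γ.star 0).get (Fin.cast hlen.symm a) = (Γ.star 0).get (Fin.cast hlen.symm b) := by
      rw [hs, hs, hab]
    simpa using (List.nodup_iff_injective_get.mp (Γ.nodup 0)) h1
  refine ⟨Equiv.ofBijective s (Finite.injective_iff_bijective.mp hinj), ?_⟩
  ext1
  funext v
  rw [Subsingleton.elim v 0]
  refine List.ext_get (by simp [ofPerm, hlen]) fun k h1 h2 => ?_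
  have := hs ⟨k, by omega⟩
  simp only [Fin.cast_mk] at this
  rw [this]
  simp [ofPerm]

/-- The admissible graphs with one vertex of the first type correspond to the orderings of the
vertices of the second type. -/
def permEquiv (m : ℕ) : Equiv.Perm (Fin m) ≃ AdmissibleGraph 1 m :=
  Equiv.ofBijective ofPerm ⟨ofPerm_injective, ofPerm_surjective⟩

@[simp]
theorem permEquiv_apply (σ : Equiv.Perm (Fin m)) : permEquiv m σ = ofPerm σ := rfl

@[simp]
theorem outdeg_ofPerm (σ : Equiv.Perm (Fin m)) (v : Fin 1) : (ofPerm σ).outdeg v = m := by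
  simp [outdeg, ofPerm]

@[simp]
theorem numEdges_ofPerm (σ : Equiv.Perm (Fin m)) : (ofPerm σ).numEdges = m := by
  simp [numEdges]

theorem edgeEquiv_ofPerm (σ : Equiv.Perm (Fin m)) (l : Fin ((ofPerm σ).outdeg 0)) :
    (ofPerm σ).edgeEquiv ⟨0, l⟩ = Fin.cast (by simp) l := by
  ext
  exact finSigmaFinEquiv_one _

theorem target_ofPerm (σ : Equiv.Perm (Fin m)) (e : Fin (ofPerm σ).numEdges) :
    (ofPerm σ).target e = Sum.inr (σ (Fin.cast (numEdges_ofPerm σ) e)) := by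
  have h : (ofPerm σ).edgeEquiv.symm e = ⟨0, Fin.cast (by simp) e⟩ := by
    rw [Equiv.symm_apply_eq, edgeEquiv_ofPerm]
    simp
  rw [target, h]
  exact (List.get_ofFn _ _).trans rfl

theorem incoming_ofPerm_inl (σ : Equiv.Perm (Fin m)) {d : ℕ}
    (I : Fin (ofPerm σ).numEdges → Fin d) (v : Fin 1) :
    (ofPerm σ).incoming I (Sum.inl v) = 1 := by
  simp [incoming, target_ofPerm]

theorem incoming_ofPerm_inr (σ : Equiv.Perm (Fin m)) {d : ℕ}
    (I : Fin (ofPerm σ).numEdges → Fin d) (w : Fin m) :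
    (ofPerm σ).incoming I (Sum.inr w) =
      partialDeriv d (I (Fin.cast (numEdges_ofPerm σ).symm (σ.symm w))) := by
  have h : ((List.finRange (ofPerm σ).numEdges).filter fun e => (ofPerm σ).target e = Sum.inr w) =
      [Fin.cast (numEdges_ofPerm σ).symm (σ.symm w)] := by
    have h1 : ∀ e ∈ List.finRange (ofPerm σ).numEdges,
        decide ((ofPerm σ).target e = Sum.inr w) =
          decide (e = Fin.cast (numEdges_ofPerm σ).symm (σ.symm w)) := by
      intro e _
      rw [decide_eq_decide, target_ofPerm, Sum.inr.injEq, ← Equiv.eq_symm_apply]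
      simp [Fin.ext_iff]
    -- Filtering by equality gives as many copies as the element occurs, here exactly one.
    rw [List.filter_congr h1, List.filter_eq,
      List.count_eq_one_of_mem (List.nodup_finRange _) (List.mem_finRange _)]
    rfl
  rw [incoming, h]
  simp

/-- The out-degree equals $m$ only propositionally, so the component of $\xi$ has to be transported
between the two degrees. -/
theorem coeff_cast {d k l : ℕ} (ξ : Multivectors d) (h : k = l) (J : Fin l → Fin d) :
    MultivectorField.coeff (ξ k) (fun i => J (Fin.cast h i)) = MultivectorField.coeff (ξ l) J := by
  subst h; rfl

/-- No edge ends at $1$, so the coefficient is not differentiated, and $\bar w$ receives only the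
edge numbered $\sigma^{-1}(w)$. -/
theorem B_ofPerm (σ : Equiv.Perm (Fin m)) {d : ℕ} (ξ : Multivectors d) :
    (ofPerm σ).B (fun _ => ξ) = ∑ J : Fin m → Fin d,
      MultivectorField.coeff (ξ m) J •
        productCochain fun w => partialDeriv d (J (σ.symm w)) := by
  rw [B]
  refine Fintype.sum_equiv
    (Equiv.arrowCongr (finCongr (numEdges_ofPerm σ)) (Equiv.refl (Fin d))) _ _ fun I => ?_
  simp only [Finset.univ_unique, Fin.default_eq_zero, Finset.prod_singleton, incoming_ofPerm_inl,
    incoming_ofPerm_inr, Module.End.one_apply]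
  congr 1
  rw [← coeff_cast ξ (outdeg_ofPerm σ 0)]
  congr 1
  funext l
  simp [edgeEquiv_ofPerm]

end AdmissibleGraph

/-! ### Wedge products, determinants and the pairing in coordinates -/

theorem wedgeForms_apply {V : Type*} [AddCommGroup V] [Module ℝ V] {k : ℕ}
    (α : Fin k → (V →ₗ[ℝ] ℝ)) (v : Fin k → V) :
    wedgeForms α v =
      ∑ σ : Equiv.Perm (Fin k), ((Equiv.Perm.sign σ : ℤ) : ℝ) * ∏ i, α i (v (σ i)) := by
  simp [wedgeForms, MultilinearMap.alternatization_apply, Units.smul_def]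

/-- `wedgeForms` is the determinant of the matrix of values. -/
theorem wedgeForms_eq_det {V : Type*} [AddCommGroup V] [Module ℝ V] {k : ℕ}
    (α : Fin k → (V →ₗ[ℝ] ℝ)) (v : Fin k → V) :
    wedgeForms α v = (Matrix.of fun j i => α i (v j)).det := by
  rw [wedgeForms_apply, Matrix.det_apply']
  simp

theorem wedgeForms_comp_perm {V : Type*} [AddCommGroup V] [Module ℝ V] {k : ℕ}
    (α : Fin k → (V →ₗ[ℝ] ℝ)) (σ : Equiv.Perm (Fin k)) :
    wedgeForms (α ∘ σ) = ((Equiv.Perm.sign σ : ℤ) : ℝ) • wedgeForms α := by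
  ext v
  rw [AlternatingMap.smul_apply, wedgeForms_eq_det, wedgeForms_eq_det, smul_eq_mul]
  exact Matrix.det_permute' σ (Matrix.of fun j i => α i (v j))

theorem alternatingMap_sum_apply {V : Type*} [AddCommGroup V] [Module ℝ V] {k : ℕ} {ι : Type*}
    (s : Finset ι) (φ : ι → V [⋀^Fin k]→ₗ[ℝ] ℝ) (v : Fin k → V) :
    (∑ i ∈ s, φ i) v = ∑ i ∈ s, φ i v :=
  map_sum (⟨⟨fun ψ => ψ v, rfl⟩, fun _ _ => rfl⟩ : V [⋀^Fin k]→ₗ[ℝ] ℝ →+ ℝ) φ s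

/-- Multilinear expansion over all index maps, not only increasing ones; this matches the sum over
all edge labellings in `B` without any sorting. -/
theorem wedgeForms_sum_smul {V : Type*} [AddCommGroup V] [Module ℝ V] {k : ℕ} {ι : Type*}
    [Fintype ι] [DecidableEq ι] (a : Fin k → ι → ℝ) (β : ι → (V →ₗ[ℝ] ℝ)) :
    wedgeForms (fun i => ∑ j, a i j • β j) =
      ∑ J : Fin k → ι, (∏ i, a i (J i)) • wedgeForms fun i => β (J i) := by
  ext v
  simp only [alternatingMap_sum_apply, AlternatingMap.smul_apply, wedgeForms_apply,
    LinearMap.sum_apply, LinearMap.smul_apply,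
    smul_eq_mul, Finset.prod_univ_sum,
    Fintype.piFinset_univ, Finset.mul_sum, Finset.prod_mul_distrib]
  rw [Finset.sum_comm]
  exact Finset.sum_congr rfl fun J _ => Finset.sum_congr rfl fun σ _ => by ring

theorem pairing_ιMulti {V : Type*} [AddCommGroup V] [Module ℝ V] {k : ℕ}
    (v : Fin k → V) (α : Fin k → (V →ₗ[ℝ] ℝ)) :
    pairing (exteriorPower.ιMulti ℝ k v) α = wedgeForms α v := by
  simp [pairing]

theorem pairing_comp_perm {V : Type*} [AddCommGroup V] [Module ℝ V] {k : ℕ} (τ : ⋀[ℝ]^k V)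
    (α : Fin k → (V →ₗ[ℝ] ℝ)) (σ : Equiv.Perm (Fin k)) :
    pairing τ (α ∘ σ) = ((Equiv.Perm.sign σ : ℤ) : ℝ) * pairing τ α := by
  simp [pairing, wedgeForms_comp_perm]

theorem component_comp_perm {d k : ℕ} (τ : ⋀[ℝ]^k (Space d)) (J : Fin k → Fin d)
    (σ : Equiv.Perm (Fin k)) :
    component τ (J ∘ σ) = ((Equiv.Perm.sign σ : ℤ) : ℝ) * component τ J :=
  pairing_comp_perm τ (fun l => (EuclideanSpace.proj (J l) : Space d →L[ℝ] ℝ).toLinearMap) σ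

theorem differential_eq_sum {d : ℕ} (f : SmoothFun d) (x : Space d) :
    differential f x = ∑ j, (partialDeriv d j f).1 x •
      (EuclideanSpace.proj j : Space d →L[ℝ] ℝ).toLinearMap := by
  refine (EuclideanSpace.basisFun (Fin d) ℝ).toBasis.ext fun i => ?_
  simp [differential, partialDeriv]

theorem pairing_differential {d k : ℕ} (τ : ⋀[ℝ]^k (Space d)) (f : Fin k → SmoothFun d)
    (x : Space d) :
    pairing τ (fun i => differential (f i) x) =
      ∑ J : Fin k → Fin d, component τ J * ∏ i, (partialDeriv d (J i) (f i)).1 x := by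
  simp only [differential_eq_sum, pairing, component, wedgeForms_sum_smul]
  simp [mul_comm]

/-! ### The multiderivation of a multivector field -/

theorem smul_assoc_cochain {d k : ℕ} (c : ℝ) (a : SmoothFun d) (P : Cochain d k) :
    (c • a) • P = c • a • P := by
  refine MultilinearMap.ext fun f => ?_
  rw [smul_apply, smul_apply, smul_apply]
  exact smul_assoc c a (P f)

/-- The cochain `∑_J ξ^J ∂_{J_1} ⊗ ⋯ ⊗ ∂_{J_k}` corresponding to a `k`-vector field. -/
def multiderivationOf (d k : ℕ) : MultivectorField d k →ₗ[ℝ] Cochain d k where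
  toFun ξ := ∑ J : Fin k → Fin d,
    MultivectorField.coeff ξ J • productCochain fun w => partialDeriv d (J w)
  map_add' ξ η := by
    rw [← Finset.sum_add_distrib]
    refine Finset.sum_congr rfl fun J _ => ?_
    rw [← add_smul]
    congr 1
    ext x
    simp [MultivectorField.coeff, component, pairing]
  map_smul' c ξ := by
    rw [RingHom.id_apply, Finset.smul_sum]
    refine Finset.sum_congr rfl fun J _ => ?_
    rw [← smul_assoc_cochain]
    congr 1
    ext x
    simp [MultivectorField.coeff, component, pairing]

theorem multiderivationOf_apply {d k : ℕ} (ξ : MultivectorField d k) (f : Fin k → SmoothFun d) :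
    multiderivationOf d k ξ f = ∑ J : Fin k → Fin d,
      MultivectorField.coeff ξ J * ∏ i, partialDeriv d (J i) (f i) := by
  simp [multiderivationOf, productCochain]

theorem multiderivationOf_apply_apply {d k : ℕ} (ξ : MultivectorField d k)
    (f : Fin k → SmoothFun d) (x : Space d) :
    (multiderivationOf d k ξ f).1 x = pairing (ξ.1 x) fun i => differential (f i) x := by
  rw [multiderivationOf_apply, pairing_differential]
  simp [MultivectorField.coeff, Finset.sum_apply, Finset.prod_apply]

theorem partialDeriv_algebraMap {d : ℕ} (j : Fin d) (c : ℝ) :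
    partialDeriv d j (algebraMap ℝ (SmoothFun d) c) = 0 := by
  ext x
  have h : (algebraMap ℝ (SmoothFun d) c).1 = fun _ => c := rfl
  simp [partialDeriv, h]

theorem partialDeriv_mul {d : ℕ} (j : Fin d) (g h : SmoothFun d) :
    partialDeriv d j (g * h) = g * partialDeriv d j h + partialDeriv d j g * h := by
  ext x
  have := fderiv_mul (smoothFun_differentiableAt g x) (smoothFun_differentiableAt h x)
  have h' := congrArg (fun L => L (EuclideanSpace.single j 1)) this
  refine h'.trans ?_
  simp [partialDeriv, mul_comm]

theorem multiderivationOf_mem {d k : ℕ} (ξ : MultivectorField d k) :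
    multiderivationOf d k ξ ∈ MultidiffOp d k := by
  refine ⟨Submodule.sum_mem _ fun J _ => Submodule.smul_mem _ _ (Submodule.subset_span
    ⟨_, fun i => Submonoid.subset_closure ⟨J i, rfl⟩, rfl⟩), fun f i c h => ?_⟩
  rw [multiderivationOf_apply]
  refine Finset.sum_eq_zero fun J _ => ?_
  rw [Finset.prod_eq_zero (Finset.mem_univ i) (by rw [h, partialDeriv_algebraMap]), mul_zero]

theorem isMultiderivation_multiderivationOf {d k : ℕ} (ξ : MultivectorField d k) :
    IsMultiderivation (multiderivationOf d k ξ) := by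
  refine ⟨fun f i g h => ?_, fun f σ => ?_⟩
  -- Only the $i$-th factor sees the updated argument, so the Leibniz rule for $\partial_{J(i)}$
  -- suffices.
  · have key (u : SmoothFun d) (J : Fin k → Fin d) :
        ∏ l, partialDeriv d (J l) (Function.update f i u l) =
          partialDeriv d (J i) u * ∏ l ∈ Finset.univ.erase i, partialDeriv d (J l) (f l) := by
      rw [← Finset.mul_prod_erase _ _ (Finset.mem_univ i), Function.update_self]
      congr 1
      exact Finset.prod_congr rfl fun l hl => by
        rw [Function.update_of_ne (Finset.ne_of_mem_erase hl)]
    simp only [multiderivationOf_apply, key, partialDeriv_mul, Finset.mul_sum, Finset.sum_mul,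
      ← Finset.sum_add_distrib]
    exact Finset.sum_congr rfl fun J _ => by ring
  -- Skew-symmetry is checked pointwise, where it is that of the pairing.
  · ext x
    have h := pairing_comp_perm (ξ.1 x) (fun i => differential (f i) x) σ
    rw [Units.smul_def, ← Int.cast_smul_eq_zsmul ℝ]
    refine (multiderivationOf_apply_apply ξ (f ∘ σ) x).trans (h.trans ?_)
    rw [← multiderivationOf_apply_apply]
    rfl

theorem IsMultiderivation.smul {d m : ℕ} {P : Cochain d m} (hP : IsMultiderivation P) (c : ℝ) :
    IsMultiderivation (c • P) := by
  refine ⟨fun f i g h => ?_, fun f σ => ?_⟩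
  · rw [smul_apply, hP.1, smul_add, smul_apply,
      smul_apply, mul_smul_comm, smul_mul_assoc]
  · rw [smul_apply, hP.2, smul_apply, smul_comm]

namespace AdmissibleGraph

variable {m : ℕ}

/-- Substituting $J\circ\sigma^{-1}$ for $J$ restores the natural order of the derivatives, and
skew-symmetry of the components pays for it with $\mathrm{sgn}(\sigma)$. -/
theorem B_ofPerm_eq (σ : Equiv.Perm (Fin m)) {d : ℕ} (ξ : Multivectors d) :
    (ofPerm σ).B (fun _ => ξ) =
      ((Equiv.Perm.sign σ : ℤ) : ℝ) • multiderivationOf d m (ξ m) := by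
  rw [B_ofPerm, multiderivationOf, LinearMap.coe_mk, AddHom.coe_mk, Finset.smul_sum]
  refine (Fintype.sum_equiv (Equiv.arrowCongr σ (Equiv.refl (Fin d))) _ _ fun J => ?_)
  rw [← smul_assoc_cochain]
  congr 1
  ext x
  have h := component_comp_perm ((ξ m).1 x) (J ∘ σ.symm) σ
  simpa [MultivectorField.coeff, Function.comp_assoc, Equiv.arrowCongr] using h

end AdmissibleGraph

/-! ## The density of the angle form on the real line -/

/-- The derivative of the angle `φ(i, x)` with respect to the real point `x`. -/
def angleDensity (x : ℝ) : ℝ := 2 * (1 + x ^ 2)⁻¹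

theorem continuous_angleDensity : Continuous angleDensity := by
  unfold angleDensity
  exact continuous_const.mul ((by fun_prop : Continuous fun x : ℝ => 1 + x ^ 2).inv₀
    fun x => by positivity)

theorem integrable_angleDensity : Integrable angleDensity :=
  integrable_inv_one_add_sq.const_mul 2

theorem integral_angleDensity : ∫ x, angleDensity x = 2 * Real.pi := by
  simp only [angleDensity]
  rw [integral_const_mul, integral_univ_inv_one_add_sq]

theorem ofReal_add_I_ne_zero (x : ℝ) : (x : ℂ) + Complex.I ≠ 0 := fun h => by
  simpa using congrArg Complex.im h

theorem ofReal_sub_I_ne_zero (x : ℝ) : (x : ℂ) - Complex.I ≠ 0 := fun h => by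
  simpa using congrArg Complex.im h

/-- Along the real line the phase is $(t-i)/(t+i)$, whose logarithmic derivative is
$2i/((t+i)(t-i))=2i/(1+t^2)$. -/
theorem angleForm_I_ofReal (x : ℝ) : angleForm (Complex.I, (x : ℂ)) (0, 1) = angleDensity x := by
  have hne := ofReal_add_I_ne_zero x
  have hne' := ofReal_sub_I_ne_zero x
  -- Differentiability is over $\mathbb R$, because the conjugate of the first point enters; it
  -- allows the derivative to be found along a path.
  have hd : DifferentiableAt ℝ anglePhase (Complex.I, (x : ℂ)) := by
    have h1 : DifferentiableAt ℝ (fun w : ℂ × ℂ => w.2 - w.1) (Complex.I, (x : ℂ)) := by fun_prop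
    have h2 : DifferentiableAt ℝ (fun w : ℂ × ℂ => w.2 - (starRingEnd ℂ) w.1)
        (Complex.I, (x : ℂ)) :=
      differentiableAt_snd.sub (Complex.conjCLE.differentiableAt.comp _ differentiableAt_fst)
    exact h1.mul (h2.fun_inv (by simpa using hne))
  have hx : HasDerivAt (fun t : ℝ => (t : ℂ)) 1 x := Complex.ofRealCLM.hasDerivAt
  have hpath : HasDerivAt (fun t : ℝ => (Complex.I, (t : ℂ))) (0, 1) x :=
    (hasDerivAt_const x Complex.I).prodMk hx
  have h1 := hd.hasFDerivAt.comp_hasDerivAt x hpath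
  have h2 : HasDerivAt (fun t : ℝ => ((t : ℂ) - Complex.I) / ((t : ℂ) + Complex.I))
      ((1 * ((x : ℂ) + Complex.I) - ((x : ℂ) - Complex.I) * 1) / ((x : ℂ) + Complex.I) ^ 2) x :=
    (hx.sub_const _).div (hx.add_const _) hne
  have h3 : anglePhase ∘ (fun t : ℝ => (Complex.I, (t : ℂ))) =
      fun t : ℝ => ((t : ℂ) - Complex.I) / ((t : ℂ) + Complex.I) := by
    funext t
    simp [anglePhase]
  rw [h3] at h1
  have h4 := h1.unique h2
  have h5 : anglePhase (Complex.I, (x : ℂ)) = ((x : ℂ) - Complex.I) / ((x : ℂ) + Complex.I) :=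
    congrFun h3 x
  have hsq : (1 : ℂ) + (x : ℂ) ^ 2 = ((x : ℂ) + Complex.I) * ((x : ℂ) - Complex.I) := by
    linear_combination Complex.I_sq
  have h6 : (anglePhase (Complex.I, (x : ℂ)))⁻¹ *
      fderiv ℝ anglePhase (Complex.I, (x : ℂ)) (0, 1) =
        ((angleDensity x : ℝ) : ℂ) * Complex.I := by
    rw [h4, h5]
    simp only [angleDensity]
    push_cast
    rw [hsq]
    field_simp
    ring
  have h7 := congrArg Complex.im h6
  simpa [angleForm] using h7

/-! ## Integration over ordered and unordered real configurations -/

theorem measurableSet_injective (m : ℕ) : MeasurableSet {x : Fin m → ℝ | Function.Injective x} := by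
  have h : {x : Fin m → ℝ | Function.Injective x} = ⋂ (i) (j) (_ : i ≠ j), {x | x i ≠ x j} := by
    ext x
    simp only [Set.mem_ofPred_eq, Set.mem_iInter]
    exact ⟨fun hx i j hij => hx.ne hij, fun hx i j hij => by_contra fun hne => hx i j hne hij⟩
  rw [h]
  exact MeasurableSet.iInter fun i => MeasurableSet.iInter fun j => MeasurableSet.iInter fun _ =>
    (measurableSet_eq_fun (measurable_pi_apply i) (measurable_pi_apply j)).compl

theorem measurableSet_strictMono_comp {m : ℕ} (τ : Fin m → Fin m) :
    MeasurableSet {x : Fin m → ℝ | StrictMono (x ∘ τ)} := by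
  have h : {x : Fin m → ℝ | StrictMono (x ∘ τ)} =
      ⋂ (i) (j) (_ : i < j), {x | x (τ i) < x (τ j)} := by
    ext x
    simp [StrictMono]
  rw [h]
  exact MeasurableSet.iInter fun i => MeasurableSet.iInter fun j => MeasurableSet.iInter fun _ =>
    measurableSet_lt (measurable_pi_apply _) (measurable_pi_apply _)

/-- Each diagonal $x_i=x_j$ is a proper linear subspace, hence null, and there are finitely many. -/
theorem ae_injective (m : ℕ) : ∀ᵐ x : Fin m → ℝ, Function.Injective x := by
  have h : ∀ i j : Fin m, i ≠ j → ∀ᵐ x : Fin m → ℝ, x i ≠ x j := by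
    intro i j hij
    let L : (Fin m → ℝ) →ₗ[ℝ] ℝ :=
      LinearMap.proj (R := ℝ) (φ := fun _ => ℝ) i - LinearMap.proj (R := ℝ) (φ := fun _ => ℝ) j
    have hL : LinearMap.ker L ≠ ⊤ := by
      intro htop
      have : L (Pi.single i 1) = 0 := by
        rw [← LinearMap.mem_ker, htop]
        trivial
      simp [L, hij.symm] at this
    have h0 := Measure.addHaar_submodule (volume : Measure (Fin m → ℝ)) _ hL
    rw [ae_iff]
    convert h0 using 2
    ext x
    simp [L, sub_eq_zero]
  have h' : ∀ᵐ x : Fin m → ℝ, ∀ i j : Fin m, i ≠ j → x i ≠ x j := by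
    rw [ae_all_iff]; intro i
    rw [ae_all_iff]; intro j
    rw [ae_all_iff]; intro hij
    exact h i j hij
  filter_upwards [h'] with x hx i j hij
  exact by_contra fun hne => hx i j hne hij

theorem setIntegral_injective {m : ℕ} (F : (Fin m → ℝ) → ℝ) :
    ∫ x in {x : Fin m → ℝ | Function.Injective x}, F x = ∫ x, F x := by
  have h : ∀ᵐ x : Fin m → ℝ, x ∈ {x : Fin m → ℝ | Function.Injective x} := ae_injective m
  rw [Measure.restrict_eq_self_of_ae_mem h]

/-- Sorting a tuple of distinct reals finds its chamber. -/
theorem iUnion_strictMono_comp (m : ℕ) :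
    ⋃ τ : Equiv.Perm (Fin m), {x : Fin m → ℝ | StrictMono (x ∘ τ)} =
      {x | Function.Injective x} := by
  ext x
  simp only [Set.mem_iUnion, Set.mem_ofPred_eq]
  constructor
  · rintro ⟨τ, hτ⟩
    simpa using hτ.injective
  · intro hx
    exact ⟨Tuple.sort x,
      (Tuple.monotone_sort x).strictMono_of_injective (hx.comp (Tuple.sort x).injective)⟩

theorem pairwise_disjoint_strictMono_comp (m : ℕ) :
    Pairwise (Function.onFun Disjoint fun τ : Equiv.Perm (Fin m) =>
      {x : Fin m → ℝ | StrictMono (x ∘ τ)}) := by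
  intro σ τ hne
  rw [Function.onFun, Set.disjoint_left]
  intro x hσ hτ
  refine hne (Equiv.ext fun i => ?_)
  have hinj : Function.Injective x := by simpa using hσ.injective
  exact hinj (congrFun (Tuple.unique_monotone hσ.monotone hτ.monotone) i)

/-- Permuting coordinates preserves Lebesgue measure and carries one chamber to another, while $F$
is symmetric. -/
theorem setIntegral_strictMono_comp {m : ℕ} (F : (Fin m → ℝ) → ℝ) (τ : Equiv.Perm (Fin m))
    (hF : ∀ x, F (x ∘ τ) = F x) :
    ∫ x in {x : Fin m → ℝ | StrictMono (x ∘ τ)}, F x = ∫ x in {x | StrictMono x}, F x := by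
  have hcoe : ∀ x : Fin m → ℝ,
      MeasurableEquiv.piCongrLeft (fun _ => ℝ) τ.symm x = x ∘ τ := by
    intro x
    funext b
    have h := MeasurableEquiv.piCongrLeft_apply_apply τ.symm (β := fun _ => ℝ) x (τ b)
    rwa [Equiv.symm_apply_apply] at h
  -- Reindexing along $\tau^{-1}$ is precomposition with $\tau$.
  have h := (volume_measurePreserving_piCongrLeft (fun _ => ℝ) τ.symm).setIntegral_preimage_emb
    (MeasurableEquiv.measurableEmbedding _) F {x | StrictMono x}
  simpa only [hcoe, hF, Set.preimage_ofPred_eq] using h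

/-- The $m!$ disjoint chambers cover almost everything and contribute equally. -/
theorem setIntegral_strictMono {m : ℕ} (F : (Fin m → ℝ) → ℝ) (hint : Integrable F)
    (hF : ∀ (τ : Equiv.Perm (Fin m)) (x), F (x ∘ τ) = F x) :
    ∫ x in {x : Fin m → ℝ | StrictMono x}, F x = (∫ x, F x) / (m.factorial : ℝ) := by
  rw [eq_div_iff (by positivity), ← setIntegral_injective, ← iUnion_strictMono_comp,
    integral_iUnion_fintype (s := fun τ : Equiv.Perm (Fin m) => {x | StrictMono (x ∘ τ)})
      (fun τ => measurableSet_strictMono_comp τ)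
      (pairwise_disjoint_strictMono_comp m) (fun τ => hint.integrableOn)]
  simp only [setIntegral_strictMono_comp F _ (hF _)]
  simp [Fintype.card_perm, mul_comm]

/-- Once $z_1=i$ is fixed the complex factor of the slice is a point; its mass $1$ makes the
projection to $\mathbb R^m$ measure preserving. -/
instance : IsProbabilityMeasure (volume : Measure (Fin 0 → ℂ)) := by
  rw [volume_pi, Measure.pi_of_empty]
  infer_instance

theorem setIntegral_snd {m : ℕ} (F : (Fin m → ℝ) → ℝ) (hF : Continuous F)
    {S : Set (Fin m → ℝ)} (hS : MeasurableSet S) :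
    ∫ p : ConfCoord 0 m in Prod.snd ⁻¹' S, F p.2 = ∫ x in S, F x := by
  have h : MeasurePreserving (Prod.snd : ConfCoord 0 m → Fin m → ℝ) := measurePreserving_snd
  rw [← h.map_eq, setIntegral_map hS hF.aestronglyMeasurable h.measurable.aemeasurable]

theorem slice_mem_conf {m : ℕ} (p : ConfCoord 0 m) :
    slice p ∈ Conf 1 m ↔ Function.Injective p.2 := by
  refine ⟨fun h => h.2.2, fun h => ⟨fun i => ?_, fun i j _ => Subsingleton.elim i j, h⟩⟩
  rw [Subsingleton.elim i 0]
  simp [slice]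

theorem slice_mem_confPlus {m : ℕ} (p : ConfCoord 0 m) :
    slice p ∈ ConfPlus 1 m ↔ StrictMono p.2 :=
  ⟨fun h => h.2, fun h => ⟨(slice_mem_conf p).mpr h.injective, h⟩⟩

theorem sliceFrame_natAdd {m : ℕ} (j : Fin m) :
    sliceFrame 0 m (Fin.natAdd (0 * 2) j) = (0, Pi.single j 1) := by
  rw [sliceFrame, finSumFinEquiv_symm_apply_natAdd, Sum.elim_inr]

/-! ## The weights of the graphs with one vertex of the first type -/

namespace AdmissibleGraph

variable {m : ℕ}

theorem edgeProj_ofPerm (σ : Equiv.Perm (Fin m)) (e : Fin (ofPerm σ).numEdges)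
    (c : ConfCoord 1 m) :
    (ofPerm σ).edgeProj e c = (c.1 0, (c.2 (σ (Fin.cast (numEdges_ofPerm σ) e)) : ℂ)) := by
  have hs : (ofPerm σ).source e = 0 := Subsingleton.elim _ _
  simp [edgeProj, target_ofPerm, hs]

/-- The point $z_1$ is fixed, so an edge form sees only the motion of its own endpoint. -/
theorem edgeForm_ofPerm (σ : Equiv.Perm (Fin m)) (p : ConfCoord 0 m)
    (e : Fin (ofPerm σ).numEdges) (j : Fin m) :
    (ofPerm σ).edgeForm (slice p) e (0, Pi.single j 1) =
      Matrix.diagonal (fun i => angleDensity (p.2 i)) j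
        (σ (Fin.cast (numEdges_ofPerm σ) e)) := by
  rw [edgeForm, LinearMap.comp_apply, edgeProj_ofPerm, edgeProj_ofPerm]
  simp only [slice, Fin.cons_zero, Pi.zero_apply]
  by_cases h : j = σ (Fin.cast (numEdges_ofPerm σ) e)
  · rw [← h, Matrix.diagonal_apply_eq, Pi.single_eq_same, Complex.ofReal_one, angleForm_I_ofReal]
  · rw [Matrix.diagonal_apply_ne _ h, Pi.single_eq_of_ne (Ne.symm h), Complex.ofReal_zero]
    exact map_zero _

theorem omega_ofPerm (σ : Equiv.Perm (Fin m)) (h : (ofPerm σ).numEdges = 0 * 2 + m)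
    (p : ConfCoord 0 m) :
    (ofPerm σ).omega (slice p) (fun b => sliceFrame 0 m (Fin.cast h b)) =
      ((Equiv.Perm.sign σ : ℤ) : ℝ) * ∏ j, angleDensity (p.2 j) := by
  have hb : ∀ b : Fin (ofPerm σ).numEdges,
      Fin.cast h b = Fin.natAdd (0 * 2) (Fin.cast (numEdges_ofPerm σ) b) := by
    intro b
    ext
    simp
  rw [← Matrix.det_diagonal, ← Matrix.det_permute', omega, wedgeForms_eq_det,
    ← Matrix.det_submatrix_equiv_self (finCongr (numEdges_ofPerm σ))]
  congr 1
  ext b e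
  rw [Matrix.of_apply, hb, sliceFrame_natAdd]
  exact edgeForm_ofPerm σ p e _

/-- Stated for a general region so as to serve both $C^+_{1,m}$ and $C_{1,m}$. -/
theorem weightOver_ofPerm (σ : Equiv.Perm (Fin m)) (R : Set (ConfCoord 1 m))
    {S : Set (Fin m → ℝ)} (hS : MeasurableSet S) (hR : ∀ p : ConfCoord 0 m, slice p ∈ R ↔ p.2 ∈ S) :
    (ofPerm σ).weightOver R = 1 / (m.factorial : ℝ) * (1 / (2 * Real.pi) ^ m) *
      (((Equiv.Perm.sign σ : ℤ) : ℝ) * ∫ x in S, ∏ j, angleDensity (x j)) := by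
  have h : (ofPerm σ).numEdges = 0 * 2 + m := by simp
  have hset : {p : ConfCoord 0 m | slice p ∈ R} = Prod.snd ⁻¹' S := Set.ext hR
  have hF : Continuous fun x : Fin m → ℝ => ∏ j, angleDensity (x j) :=
    continuous_finsetProd _ fun j _ => continuous_angleDensity.comp (continuous_apply j)
  -- The truncated subtraction in the exponent of $2\pi$ loses nothing.
  have hm : 2 * (0 + 1) + m - 2 = m := by omega
  rw [weightOver, dif_pos h, integral, hset]
  simp only [hm, outdeg_ofPerm]
  rw [integral_congr_ae (Filter.Eventually.of_forall (omega_ofPerm σ h))]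
  rw [integral_const_mul, setIntegral_snd _ hF hS]
  simp

theorem integral_prod_angleDensity :
    ∫ x : Fin m → ℝ, ∏ j, angleDensity (x j) = (2 * Real.pi) ^ m := by
  rw [integral_fintype_prod_volume_eq_pow angleDensity, integral_angleDensity, Fintype.card_fin]

theorem weightOver_conf_ofPerm (σ : Equiv.Perm (Fin m)) :
    (ofPerm σ).weightOver (Conf 1 m) = ((Equiv.Perm.sign σ : ℤ) : ℝ) / (m.factorial : ℝ) := by
  rw [weightOver_ofPerm σ _ (measurableSet_injective m) slice_mem_conf, setIntegral_injective,
    integral_prod_angleDensity]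
  have := Real.pi_pos
  field_simp

theorem weight_ofPerm (σ : Equiv.Perm (Fin m)) :
    (ofPerm σ).weight = ((Equiv.Perm.sign σ : ℤ) : ℝ) / (m.factorial : ℝ) ^ 2 := by
  rw [weight, weightOver_ofPerm σ _ (measurableSet_strictMono_comp id) slice_mem_confPlus]
  simp only [Function.comp_id]
  rw [setIntegral_strictMono _ (Integrable.fintype_prod fun _ => integrable_angleDensity)
      fun τ x => Equiv.prod_comp τ fun j => angleDensity (x j), integral_prod_angleDensity]
  have := Real.pi_pos
  field_simp

end AdmissibleGraph

/-! ### Summation over the orderings and the HKR map -/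

theorem sign_mul_sign {m : ℕ} (σ : Equiv.Perm (Fin m)) :
    ((Equiv.Perm.sign σ : ℤ) : ℝ) * ((Equiv.Perm.sign σ : ℤ) : ℝ) = 1 := by
  rw [← Int.cast_mul, ← Units.val_mul, Int.units_mul_self, Units.val_one, Int.cast_one]

theorem sum_perm_const (m : ℕ) :
    ∑ _σ : Equiv.Perm (Fin m), 1 / (m.factorial : ℝ) ^ 2 = 1 / (m.factorial : ℝ) := by
  rw [Finset.sum_const, Finset.card_univ, Fintype.card_perm, Fintype.card_fin, nsmul_eq_mul]
  field_simp

/-- The sign of the weight cancels that of the operator, so all $m!$ graphs contribute the same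
term. -/
theorem U1_eq {d : ℕ} (ξ : Multivectors d) (m : ℕ) :
    U1 ξ m = (1 / (m.factorial : ℝ)) • multiderivationOf d m (ξ m) := by
  have h (σ : Equiv.Perm (Fin m)) :
      (AdmissibleGraph.permEquiv m σ).weight • (AdmissibleGraph.permEquiv m σ).B (fun _ => ξ) =
        (1 / (m.factorial : ℝ) ^ 2) • multiderivationOf d m (ξ m) := by
    rw [AdmissibleGraph.permEquiv_apply, AdmissibleGraph.weight_ofPerm,
      AdmissibleGraph.B_ofPerm_eq, smul_smul, div_mul_eq_mul_div, sign_mul_sign]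
  calc U1 ξ m = ∑ σ, (AdmissibleGraph.permEquiv m σ).weight •
        (AdmissibleGraph.permEquiv m σ).B (fun _ => ξ) :=
      ((AdmissibleGraph.permEquiv m).sum_comp fun Γ => Γ.weight • Γ.B fun _ => ξ).symm
    _ = _ := by rw [Finset.sum_congr rfl fun σ _ => h σ, ← Finset.sum_smul, sum_perm_const]

theorem U1_apply_apply {d : ℕ} (ξ : Multivectors d) (m : ℕ) (f : Fin m → SmoothFun d)
    (x : Space d) : (U1 ξ m f).1 x = hkr (ξ m) f x := by
  rw [U1_eq, hkr, ← multiderivationOf_apply_apply]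
  rfl

theorem hkr_of_isWedge {d k : ℕ} {ξ : MultivectorField d k} {X : Fin k → Space d → Space d}
    (h : IsWedge ξ X) (f : Fin k → SmoothFun d) (x : Space d) :
    hkr ξ f x = 1 / (k.factorial : ℝ) * ∑ σ : Equiv.Perm (Fin k),
      ((Equiv.Perm.sign σ : ℤ) : ℝ) * ∏ i, differential (f i) x (X (σ i) x) := by
  rw [hkr, h x, pairing_ιMulti, wedgeForms_apply]

/-- The Hochschild–Kostant–Rosenberg map `ξ ↦ (1 / k!) ⟨ξ, df_1 ∧ ⋯ ∧ df_k⟩`. -/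
def hkrMap (d : ℕ) : Multivectors d →ₗ[ℝ] MultidiffOps d :=
  DirectSum.lmap fun m =>
    (1 / (m.factorial : ℝ)) • (multiderivationOf d m).codRestrict (MultidiffOp d m)
      multiderivationOf_mem

theorem hkrMap_apply {d : ℕ} (ξ : Multivectors d) (m : ℕ) :
    ((hkrMap d ξ m : MultidiffOp d m) : Cochain d m) = U1 ξ m := by
  rw [U1_eq, hkrMap, DirectSum.lmap_apply]
  rfl

end

end Kontsevich

theorem lemmaI (d : ℕ) :
    -- `U_1` is a linear map from multivector fields to multidifferential operators, namely the
    -- natural map that sends each multivector field to the corresponding multiderivation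
    (∃ Φ : Multivectors d →ₗ[ℝ] MultidiffOps d,
      (∀ (ξ : Multivectors d) (m : ℕ), ((Φ ξ m : MultidiffOp d m) : Cochain d m) = U1 ξ m) ∧
      (∀ (ξ : Multivectors d) (m : ℕ), IsMultiderivation (U1 ξ m)) ∧
      (∀ (ξ : Multivectors d) (m : ℕ) (f : Fin m → SmoothFun d) (x : Space d),
        (U1 ξ m f).1 x = hkr (ξ m) f x) ∧
      (∀ (k : ℕ) (ξ : MultivectorField d k) (X : Fin k → Space d → Space d), IsWedge ξ X →
        ∀ (f : Fin k → SmoothFun d) (x : Space d),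
          (U1 (DirectSum.of (fun j => MultivectorField d j) k ξ) k f).1 x =
            1 / (k.factorial : ℝ) * ∑ σ : Equiv.Perm (Fin k),
              ((Equiv.Perm.sign σ : ℤ) : ℝ) * ∏ i, differential (f i) x (X (σ i) x)) ∧
      (∀ (k : ℕ) (ξ : MultivectorField d k) (m : ℕ), m ≠ k →
        U1 (DirectSum.of (fun j => MultivectorField d j) k ξ) m = 0)) ∧
    -- `𝒢_{1,m}` consists of one graph, up to the order of its edges, of total weight `1 / m!`
    (∀ m : ℕ, ∃ Γ : Equiv.Perm (Fin m) ≃ AdmissibleGraph 1 m,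
      (∀ σ, (Γ σ).star 0 = List.ofFn fun l => Sum.inr (σ l)) ∧
      (∀ σ, (Γ σ).weight = ((Equiv.Perm.sign σ : ℤ) : ℝ) / (m.factorial : ℝ) ^ 2) ∧
      (∑ σ, ((Equiv.Perm.sign σ : ℤ) : ℝ) * (Γ σ).weight = 1 / (m.factorial : ℝ)) ∧
      (∀ σ, (Γ σ).weightOver (Conf 1 m) =
        ((Equiv.Perm.sign σ : ℤ) : ℝ) / (m.factorial : ℝ)) ∧
      (∀ (ξ : Multivectors d) (f : Fin m → SmoothFun d),
        (Γ 1).B (fun _ => ξ) f =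
          ∑ J : Fin m → Fin d, MultivectorField.coeff (ξ m) J * ∏ l, partialDeriv d (J l) (f l)) ∧
      (∀ ξ : Multivectors d, U1 ξ m = (1 / (m.factorial : ℝ)) • (Γ 1).B fun _ => ξ)) := by
  refine ⟨⟨hkrMap d, hkrMap_apply, fun ξ m => ?_, U1_apply_apply, fun k ξ X h f x => ?_,
    fun k ξ m hm => ?_⟩, fun m => ⟨AdmissibleGraph.permEquiv m, fun σ => rfl,
      AdmissibleGraph.weight_ofPerm, ?_, AdmissibleGraph.weightOver_conf_ofPerm,
      fun ξ f => ?_, fun ξ => ?_⟩⟩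
  · rw [U1_eq]
    exact (isMultiderivation_multiderivationOf _).smul _
  · rw [U1_apply_apply, DirectSum.of_eq_same, hkr_of_isWedge h]
  -- Only the degree $m$ part of a multivector field yields operators with $m$ arguments.
  · rw [U1_eq, DirectSum.of_eq_of_ne _ _ _ hm, map_zero, smul_zero]
  · rw [← sum_perm_const]
    refine Finset.sum_congr rfl fun σ _ => ?_
    rw [AdmissibleGraph.permEquiv_apply, AdmissibleGraph.weight_ofPerm, ← mul_div_assoc,
      sign_mul_sign]
  · rw [AdmissibleGraph.permEquiv_apply, AdmissibleGraph.B_ofPerm_eq, ← multiderivationOf_apply]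
    simp
  · rw [AdmissibleGraph.permEquiv_apply, AdmissibleGraph.B_ofPerm_eq, U1_eq]
    simp
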